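/- Let $\mathbb{K}$ be an algebraically closed field of characteristic zero, let $k\ge 1$, $m\ge 0$, $n>1$ be integers and let $a_1,\dots,a_m>1$ be integers. Let $X$ be the trinomial hypersurface $$x_1\cdots x_k\,y_1^{a_1}\cdots y_m^{a_m}=z^n+1,\qquad B=\mathbb{K}[X]=\mathbb{K}[x_1,\dots,x_k,y_1,\dots,y_m,z]/(x_1\cdots x_k y_1^{a_1}\cdots y_m^{a_m}-z^n-1).$$ Grade $B$ by the group $G=\mathbb{Z}^{k+m+1}/\langle(1,\dots,1,a_1,\dots,a_m,0),(0,\dots,0,n)\rangle$, the degree of each variable being the class of the corresponding standard basis vector; this is the finest grading of $B$ in which all variables are homogeneous, and it corresponds to the action on $X$ of the quasitorus with character group $G$. Passing to $G$ modulo its torsion subgroup gives the grading corresponding to the action of the torus that is the identity component of this quasitorus. A $\mathbb{K}$-linear derivation of $B$ is an LND if it is locally nilpotent, and it is homogeneous if it sends homogeneous elements to homogeneous elements. A nonzero LND $\delta$ of $B$ is maximal if every nonzero LND $D$ of $B$ with $[\delta,D]=0$ satisfies $\operatorname{Ker} D=\operatorname{Ker}\delta$. Then every nonzero LND of $B$ that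 is homogeneous with respect to the quasitorus grading or with respect to the torus grading is maximal. -/

import Mathlib

namespace LND

section General

variable {K B : Type*} [Field K] [CommRing B] [Algebra K B]

/-- A derivation is locally nilpotent if every element is killed by some iterate of it. -/
def IsLocallyNilpotent (δ : Derivation K B B) : Prop :=
  ∀ f : B, ∃ r : ℕ, (⇑δ)^[r] f = 0

/-- Two derivations are equivalent if their kernels coincide. -/
def Equivalent (δ D : Derivation K B B) : Prop :=
  LinearMap.ker (δ : B →ₗ[K] B) = LinearMap.ker (D : B →ₗ[K] B)

/-- A nonzero locally nilpotent derivation is maximal if every nonzero locally nilpotent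
derivation commuting with it is equivalent to it. (The zero derivation commutes with
everything, so it has to be left out on both sides.) -/
structure IsMaximal (δ : Derivation K B B) : Prop where
  ne_zero : δ ≠ 0
  isLocallyNilpotent : IsLocallyNilpotent δ
  equivalent_of_commute : ∀ D : Derivation K B B,
    D ≠ 0 → IsLocallyNilpotent D → ⁅δ, D⁆ = 0 → Equivalent δ D

/-- A derivation is homogeneous for a family of homogeneous components if it sends homogeneous
elements to homogeneous elements. -/
def IsHomogeneous {G : Type*} (𝒜 : G → Submodule K B) (δ : Derivation K B B) : Prop :=
  ∀ f : B, (∃ g, f ∈ 𝒜 g) → ∃ g', δ f ∈ 𝒜 g'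

end General

/-- The variables `x₁, …, x_k, y₁, …, y_m, z`. -/
inductive Var (k m : ℕ) : Type
  | x (i : Fin k) : Var k m
  | y (j : Fin m) : Var k m
  | z : Var k m

section Hypersurface

variable (K : Type*) [Field K] {k m : ℕ} (a : Fin m → ℕ) (n : ℕ)

/-- The polynomial `x₁ ⋯ x_k y₁^{a₁} ⋯ y_m^{a_m} - (z^n + 1)`. -/
noncomputable def equation : MvPolynomial (Var k m) K :=
  (∏ i : Fin k, MvPolynomial.X (Var.x i)) * (∏ j : Fin m, MvPolynomial.X (Var.y j) ^ a j)
    - (MvPolynomial.X Var.z ^ n + 1)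

/-- The algebra `𝕂[X]` of regular functions on the hypersurface
`x₁ ⋯ x_k y₁^{a₁} ⋯ y_m^{a_m} = z^n + 1`. -/
abbrev CoordRing (k : ℕ) {m : ℕ} (a : Fin m → ℕ) (n : ℕ) : Type _ :=
  MvPolynomial (Var k m) K ⧸ Ideal.span {equation K (k := k) a n}

/-- The row `(1, …, 1, a₁, …, a_m, 0)` of the exponent matrix. -/
def rowXY (k : ℕ) {m : ℕ} (a : Fin m → ℕ) : Var k m → ℤ
  | Var.x _ => 1
  | Var.y j => (a j : ℤ)
  | Var.z => 0

/-- The row `(0, …, 0, 0, …, 0, n)` of the exponent matrix. -/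
def rowZ (k m n : ℕ) : Var k m → ℤ
  | Var.x _ => 0
  | Var.y _ => 0
  | Var.z => (n : ℤ)

/-- The grading group of the finest grading for which all variables are homogeneous: `ℤ^{k+m+1}`
modulo the subgroup generated by the rows of the exponent matrix. It is the character group of the
quasitorus acting on the hypersurface. -/
abbrev GradingGroup (k : ℕ) {m : ℕ} (a : Fin m → ℕ) (n : ℕ) : Type :=
  (Var k m → ℤ) ⧸ AddSubgroup.closure {rowXY k a, rowZ k m n}

open Classical in
/-- The degree of a variable: the class of the corresponding standard basis vector. -/
noncomputable def weight (v : Var k m) : GradingGroup k a n :=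
  QuotientAddGroup.mk (Pi.single v (1 : ℤ))

/-- The grading group modulo torsion: the character group of the torus that is the
identity component of the quasitorus. -/
abbrev TorusGradingGroup (k : ℕ) {m : ℕ} (a : Fin m → ℕ) (n : ℕ) : Type :=
  GradingGroup k a n ⧸ AddCommGroup.torsion (GradingGroup k a n)

/-- The degree of a variable with respect to the torus. -/
noncomputable def torusWeight (v : Var k m) : TorusGradingGroup k a n :=
  QuotientAddGroup.mk (weight a n v)

/-- The homogeneous component of degree `g` of the coordinate ring, for given degrees `w` of the
variables: the image of the polynomials that are weighted homogeneous of degree `g`. -/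
noncomputable def component {G : Type*} [AddCommGroup G] (w : Var k m → G) (g : G) :
    Submodule K (CoordRing K k a n) :=
  (MvPolynomial.weightedHomogeneousSubmodule K w g).map
    (Ideal.Quotient.mkₐ K (Ideal.span {equation K (k := k) a n})).toLinearMap

/-- Homogeneity with respect to the action of the quasitorus (the finest grading). -/
def IsQuasitorusHomogeneous
    (δ : Derivation K (CoordRing K k a n) (CoordRing K k a n)) : Prop :=
  IsHomogeneous (component K a n (weight a n)) δ

/-- Homogeneity with respect to the action of the torus (the finest grading modulo torsion). -/
def IsTorusHomogeneous
    (δ : Derivation K (CoordRing K k a n) (CoordRing K k a n)) : Prop :=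
  IsHomogeneous (component K a n (torusWeight a n)) δ

end Hypersurface

end LND

/-! Write the relation as `∏ u v ^ A v = z ^ n + 1`, and let `R` be the subalgebra generated by the
`u w` with `w ≠ v`, where `A v = 1`. If `δ` is locally nilpotent and elementary at `v`, then `z` has
degree 1 and `u v` has degree `n` for `δ`, so `z ^ (d % n) * u v ^ (d / n)` has degree exactly `d`.
These elements span the algebra over `R`, hence the kernel of `δ ^ r` is spanned by the first `r` of
them. In particular `ker δ = R` depends on `v` only.

A nonzero locally nilpotent `D` commuting with `δ` preserves these kernels. This forces `D z` into
`R` and `D (u w) = 0` for `w ≠ v`, so `D` is elementary at the same `v` and has the same kernel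
(`isElementary_of_commute`, `isMaximal`).

It remains to see that homogeneous derivations are elementary (`exists_isElementary`). Homogeneous
elements are monomials in the `u v` times polynomials in `z`; comparing the degrees of `δ z` and `δ
(u v)` leaves a single `u v` outside the kernel, and local nilpotency then gives `A v = 1`. -/

namespace LND

/-! ### Degree functions of locally nilpotent derivations. -/

section Toolkit

variable {K B : Type*} [Field K] [CommRing B] [Algebra K B]

theorem iterate_map_add (δ : Derivation K B B) (n : ℕ) (a b : B) :
    δ^[n] (a + b) = δ^[n] a + δ^[n] b := by
  simp

theorem iterate_map_zero (δ : Derivation K B B) (n : ℕ) : δ^[n] (0 : B) = 0 := by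
  simp

theorem iterate_map_sum {ι : Type*} (δ : Derivation K B B) (n : ℕ) (s : Finset ι) (f : ι → B) :
    δ^[n] (∑ i ∈ s, f i) = ∑ i ∈ s, δ^[n] (f i) := by
  induction n generalizing f with
  | zero => rfl
  | succ n ih => simp [Function.iterate_succ_apply, map_sum, ih]

theorem iterate_eq_zero_of_le {δ : Derivation K B B} {f : B} {r s : ℕ} (hrs : r ≤ s)
    (h : δ^[r] f = 0) : δ^[s] f = 0 := by
  obtain ⟨t, rfl⟩ := Nat.exists_eq_add_of_le' hrs
  rw [Function.iterate_add_apply, h, iterate_map_zero]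

theorem iterate_mul_of_map_eq_zero {δ : Derivation K B B} {c : B} (hc : δ c = 0) (n : ℕ) (f : B) :
    δ^[n] (c * f) = c * δ^[n] f := by
  induction n generalizing f with
  | zero => rfl
  | succ n ih => simp [Function.iterate_succ_apply, hc, ih]

/-- The general Leibniz rule. -/
theorem iterate_leibniz (δ : Derivation K B B) (n : ℕ) (a b : B) :
    δ^[n] (a * b) =
      ∑ ij ∈ Finset.HasAntidiagonal.antidiagonal n, n.choose ij.1 • (δ^[ij.1] a * δ^[ij.2] b) := by
  induction n with
  | zero => simp
  | succ n ih =>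
    rw [Finset.sum_antidiagonal_choose_succ_nsmul
      (M := B) (fun i j => δ^[i] a * δ^[j] b) n]
    simp only [Function.iterate_succ_apply', ih, map_sum, map_nsmul, Derivation.leibniz, smul_add,
      Finset.sum_add_distrib, smul_eq_mul]
    congr 1
    exact Finset.sum_congr rfl fun ij hij => by
      rw [n.choose_symm_of_eq_add (Finset.HasAntidiagonal.mem_antidiagonal.1 hij).symm, mul_comm]

/-- `f` has degree `d` for `δ` if `d + 1` is the least number of times that `δ` has to be applied
to `f` in order to kill it. -/
def HasDeg (δ : Derivation K B B) (f : B) (d : ℕ) : Prop :=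
  δ^[d] f ≠ 0 ∧ δ^[d + 1] f = 0

theorem HasDeg.ne_zero {δ : Derivation K B B} {f : B} {d : ℕ} (h : HasDeg δ f d) : f ≠ 0 := by
  rintro rfl
  exact h.1 (iterate_map_zero δ d)

theorem HasDeg.iterate_eq_zero_iff {δ : Derivation K B B} {f : B} {d r : ℕ} (h : HasDeg δ f d) :
    δ^[r] f = 0 ↔ d < r :=
  ⟨fun hr => by
    by_contra! hlt
    exact h.1 (iterate_eq_zero_of_le hlt hr), fun hlt => iterate_eq_zero_of_le hlt h.2⟩

theorem HasDeg.unique {δ : Derivation K B B} {f : B} {d e : ℕ} (h : HasDeg δ f d)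
    (h' : HasDeg δ f e) : d = e := by
  have h1 := h.iterate_eq_zero_iff.1 h'.2
  have h2 := h'.iterate_eq_zero_iff.1 h.2
  omega

theorem hasDeg_zero {δ : Derivation K B B} {f : B} (hf : f ≠ 0) (h : δ f = 0) : HasDeg δ f 0 :=
  ⟨hf, h⟩

theorem HasDeg.map {δ : Derivation K B B} {f : B} {d : ℕ} (h : HasDeg δ f (d + 1)) :
    HasDeg δ (δ f) d := h

theorem IsLocallyNilpotent.exists_hasDeg {δ : Derivation K B B} (hδ : IsLocallyNilpotent δ) {f : B}
    (hf : f ≠ 0) : ∃ d, HasDeg δ f d := by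
  classical
  have h := hδ f
  obtain ⟨d, hd⟩ : ∃ d, Nat.find h = d + 1 :=
    Nat.exists_eq_succ_of_ne_zero fun h0 => hf (by simpa [h0] using Nat.find_spec h)
  exact ⟨d, Nat.find_min h (by omega), hd ▸ Nat.find_spec h⟩

theorem iterate_mul_eq_zero {δ : Derivation K B B} {f g : B} {d e r : ℕ}
    (hf : δ^[d + 1] f = 0) (hg : δ^[e + 1] g = 0) (hr : d + e < r) : δ^[r] (f * g) = 0 := by
  rw [iterate_leibniz]
  refine Finset.sum_eq_zero fun ij hij => ?_
  rw [Finset.HasAntidiagonal.mem_antidiagonal] at hij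
  rcases lt_or_ge d ij.1 with h | h
  · rw [iterate_eq_zero_of_le h hf, zero_mul, smul_zero]
  · rw [iterate_eq_zero_of_le (show e + 1 ≤ ij.2 by omega) hg, mul_zero, smul_zero]

variable [IsDomain B] [CharZero B]

/-- In the Leibniz formula for `δ^[d + e]` only the term `(d, e)` survives, and its binomial
coefficient is nonzero in characteristic zero. -/
theorem HasDeg.mul {δ : Derivation K B B} {f g : B} {d e : ℕ} (hf : HasDeg δ f d)
    (hg : HasDeg δ g e) : HasDeg δ (f * g) (d + e) := by
  refine ⟨?_, iterate_mul_eq_zero hf.2 hg.2 (Nat.lt_succ_self _)⟩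
  rw [iterate_leibniz, Finset.sum_eq_single (d, e)]
  · rw [nsmul_eq_mul]
    exact mul_ne_zero (Nat.cast_ne_zero.2 (Nat.choose_pos (Nat.le_add_right _ _)).ne')
      (mul_ne_zero hf.1 hg.1)
  · intro ij hij hne
    rw [Finset.HasAntidiagonal.mem_antidiagonal] at hij
    rcases lt_trichotomy d ij.1 with h | h | h
    · rw [iterate_eq_zero_of_le h hf.2, zero_mul, smul_zero]
    · exact absurd (Prod.ext h.symm (by simp; omega)) hne
    · rw [iterate_eq_zero_of_le (show e + 1 ≤ ij.2 by omega) hg.2, mul_zero, smul_zero]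
  · simp

theorem HasDeg.pow {δ : Derivation K B B} {f : B} {d : ℕ} (hf : HasDeg δ f d) (n : ℕ) :
    HasDeg δ (f ^ n) (n * d) := by
  induction n with
  | zero => simpa using hasDeg_zero (δ := δ) (one_ne_zero (α := B)) (by simp)
  | succ n ih => rw [pow_succ, Nat.succ_mul]; exact ih.mul hf

namespace IsLocallyNilpotent

variable {δ : Derivation K B B}

/-- Degrees add up, so a product of degree 0 has factors of degree 0: the kernel is factorially
closed. -/
theorem map_eq_zero_of_map_mul_eq_zero (hδ : IsLocallyNilpotent δ) {f g : B} (hne : f * g ≠ 0)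
    (h : δ (f * g) = 0) : δ f = 0 := by
  obtain ⟨d, hd⟩ := hδ.exists_hasDeg (left_ne_zero_of_mul hne)
  obtain ⟨e, he⟩ := hδ.exists_hasDeg (right_ne_zero_of_mul hne)
  obtain rfl : d = 0 := by have := (hd.mul he).unique (hasDeg_zero hne h); omega
  exact hd.2

theorem map_eq_zero_of_dvd (hδ : IsLocallyNilpotent δ) {f g : B} (hfg : f ∣ g) (hg : g ≠ 0)
    (h : δ g = 0) : δ f = 0 := by
  obtain ⟨r, rfl⟩ := hfg
  exact hδ.map_eq_zero_of_map_mul_eq_zero hg h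

/-- Applying `δ` lowers a positive degree by one, whereas a nonzero multiple of `f` has at least the
degree of `f`. -/
theorem map_eq_zero_of_dvd_map (hδ : IsLocallyNilpotent δ) {f : B} (h : f ∣ δ f) : δ f = 0 := by
  by_contra hne
  obtain ⟨g, hg⟩ := h
  have hne' := hg ▸ hne
  obtain ⟨d, hd⟩ := hδ.exists_hasDeg (left_ne_zero_of_mul hne')
  obtain ⟨e, he⟩ := hδ.exists_hasDeg (right_ne_zero_of_mul hne')
  cases d with
  | zero => exact hne hd.2
  | succ d =>
    have := hd.map
    rw [hg] at this
    have := this.unique (hd.mul he)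
    omega

end IsLocallyNilpotent

end Toolkit

end LND

namespace LND

/-! ### Elementary derivations and the derivations commuting with them. -/

section Trinomial

variable {K B I : Type*} [Field K] [CommRing B] [Algebra K B]

variable (K) in
/-- The algebra `B` is generated by nonzero elements `u v` and an element `z` that satisfy the
relation `∏ u v ^ A v = z ^ n + 1`. -/
structure IsTrinomial [Fintype I] (u : I → B) (z : B) (A : I → ℕ) (n : ℕ) : Prop where
  prod_eq : ∏ v, u v ^ A v = z ^ n + 1
  adjoin_eq_top : Algebra.adjoin K (insert z (Set.range u)) = ⊤
  ne_zero : ∀ v, u v ≠ 0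
  exponent_ne_zero : ∀ v, A v ≠ 0
  one_lt : 1 < n

variable (K) in
/-- The subalgebra generated by all the elements `u w` with `w ≠ v`. -/
abbrev others (u : I → B) (v : I) : Subalgebra K B :=
  Algebra.adjoin K (u '' {v}ᶜ)

/-- The product of all the powers `u w ^ A w` with `w ≠ v`. -/
def cofactor [Fintype I] [DecidableEq I] (u : I → B) (A : I → ℕ) (v : I) : B :=
  ∏ w ∈ Finset.univ.erase v, u w ^ A w

/-- A derivation that kills all the `u w` with `w ≠ v`, and sends `z` to a nonzero element of the
subalgebra generated by them. -/
structure IsElementary (u : I → B) (z : B) (v : I) (δ : Derivation K B B) : Prop where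
  map_eq_zero : ∀ w ≠ v, δ (u w) = 0
  map_mem : δ z ∈ others K u v
  map_ne_zero : δ z ≠ 0

theorem mem_others (u : I → B) {v w : I} (h : w ≠ v) : u w ∈ others K u v :=
  Algebra.subset_adjoin ⟨w, h, rfl⟩

theorem map_eq_zero_of_mem_others {u : I → B} {v : I} {δ : Derivation K B B}
    (h : ∀ w ≠ v, δ (u w) = 0) {c : B} (hc : c ∈ others K u v) : δ c = 0 := by
  induction hc using Algebra.adjoin_induction with
  | mem x hx => obtain ⟨w, hw, rfl⟩ := hx; exact h w hw
  | algebraMap r => simp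
  | add x y _ _ hx hy => simp [hx, hy]
  | mul x y _ _ hx hy => simp [hx, hy]

theorem IsElementary.hasDeg_z {u : I → B} {z : B} {v : I} {δ : Derivation K B B}
    (hδ : IsElementary u z v δ) : HasDeg δ z 1 :=
  ⟨hδ.map_ne_zero, map_eq_zero_of_mem_others hδ.map_eq_zero hδ.map_mem⟩

variable [Fintype I]

theorem cofactor_mem_others [DecidableEq I] (u : I → B) (A : I → ℕ) (v : I) :
    cofactor u A v ∈ others K u v :=
  prod_mem fun _ hw => pow_mem (mem_others u (Finset.ne_of_mem_erase hw)) _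

theorem dvd_cofactor [DecidableEq I] (u : I → B) {A : I → ℕ} {v w : I} (hA : A w ≠ 0)
    (h : w ≠ v) : u w ∣ cofactor u A v :=
  (dvd_pow_self _ hA).trans (Finset.dvd_prod_of_mem (fun w => u w ^ A w) (by simpa using h))

namespace IsTrinomial

variable {u : I → B} {z : B} {A : I → ℕ} {n : ℕ}

theorem mul_cofactor [DecidableEq I] (h : IsTrinomial K u z A n) (v : I) :
    u v ^ A v * cofactor u A v = z ^ n + 1 := by
  rw [← h.prod_eq, cofactor, Finset.mul_prod_erase _ (fun w => u w ^ A w) (Finset.mem_univ v)]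

theorem cofactor_ne_zero [IsDomain B] [DecidableEq I] (h : IsTrinomial K u z A n) (v : I) :
    cofactor u A v ≠ 0 :=
  Finset.prod_ne_zero_iff.2 fun w _ => pow_ne_zero _ (h.ne_zero w)

theorem derivation_eq_zero (h : IsTrinomial K u z A n) {δ : Derivation K B B} (hz : δ z = 0)
    (hu : ∀ v, δ (u v) = 0) : δ = 0 :=
  Derivation.ext_of_adjoin_eq_top _ h.adjoin_eq_top (by
    rintro _ (rfl | ⟨v, rfl⟩)
    · simpa using hz
    · simpa using hu v)

/-- The elements `z ^ i * u v ^ j` with `i < n` span the algebra over the subalgebra generated by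
the other elements. -/
theorem span_eq_top [DecidableEq I] (h : IsTrinomial K u z A n) {v : I} (hv : A v = 1) :
    Submodule.span (others K u v) (Set.range fun d => z ^ (d % n) * u v ^ (d / n)) = ⊤ := by
  set S := Submodule.span (others K u v) (Set.range fun d => z ^ (d % n) * u v ^ (d / n))
  have hn : 0 < n := by have := h.one_lt; omega
  have basis_mem (d : ℕ) : z ^ (d % n) * u v ^ (d / n) ∈ S := Submodule.subset_span ⟨d, rfl⟩
  have smul_mem (c : B) (hc : c ∈ others K u v) {s : B} (hs : s ∈ S) : c * s ∈ S :=
    S.smul_mem (⟨c, hc⟩ : others K u v) hs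
  have mul_mem_of {g : B} (hg : ∀ d, g * (z ^ (d % n) * u v ^ (d / n)) ∈ S) :
      ∀ s ∈ S, g * s ∈ S := by
    intro s hs
    induction hs using Submodule.span_induction with
    | mem x hx => obtain ⟨d, rfl⟩ := hx; exact hg d
    | zero => simp
    | add x y _ _ hx hy => rw [mul_add]; exact add_mem hx hy
    | smul c x _ hx => rw [mul_smul_comm]; exact S.smul_mem c hx
  -- The overflow `z ^ n` is rewritten by the relation as `u v * cofactor u A v - 1`.
  have hzpow (j : ℕ) : z ^ n * u v ^ j ∈ S := by
    have heq : z ^ n * u v ^ j = cofactor u A v * (z ^ (((j + 1) * n) % n) *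
        u v ^ (((j + 1) * n) / n)) - z ^ ((j * n) % n) * u v ^ ((j * n) / n) := by
      have := h.mul_cofactor v
      rw [hv, pow_one] at this
      rw [Nat.mul_mod_left, Nat.mul_mod_left, Nat.mul_div_cancel _ hn, Nat.mul_div_cancel _ hn]
      linear_combination -u v ^ j * this
    rw [heq]
    exact sub_mem (smul_mem _ (cofactor_mem_others u A v) (basis_mem _)) (basis_mem _)
  have hgen : ∀ g ∈ Algebra.adjoin K (insert z (Set.range u)), ∀ s ∈ S, g * s ∈ S := by
    intro g hg
    induction hg using Algebra.adjoin_induction with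
    | mem x hx =>
      obtain rfl | ⟨w, rfl⟩ := hx
      · refine mul_mem_of fun d => ?_
        rw [← mul_assoc, ← pow_succ']
        rcases eq_or_lt_of_le (show d % n + 1 ≤ n from Nat.mod_lt d hn) with hd | hd
        · rw [hd]
          exact hzpow _
        · have hdiv : (d + 1) % n = d % n + 1 ∧ (d + 1) / n = d / n := by
            rw [Nat.mod_eq_iff, Nat.div_eq_iff hn]
            have := Nat.div_add_mod d n
            refine ⟨Or.inr ⟨hd, d / n, by omega⟩, by rw [mul_comm]; omega, ?_⟩
            rw [mul_comm]; omega
          have := basis_mem (d + 1)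
          rwa [hdiv.1, hdiv.2] at this
      · by_cases hw : w = v
        · subst hw
          refine mul_mem_of fun d => ?_
          have := basis_mem (d + n)
          rwa [Nat.add_mod_right, Nat.add_div_right _ hn, pow_succ', mul_left_comm] at this
        · exact fun s hs => smul_mem _ (mem_others u hw) hs
    | algebraMap r => exact fun s hs => smul_mem _ (Subalgebra.algebraMap_mem _ r) hs
    | add x y _ _ hx hy => exact fun s hs => by rw [add_mul]; exact add_mem (hx s hs) (hy s hs)
    | mul x y _ _ hx hy => exact fun s hs => by rw [mul_assoc]; exact hx _ (hy s hs)
  refine eq_top_iff.2 fun f _ => ?_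
  have := hgen f (by rw [h.adjoin_eq_top]; trivial) 1 (by simpa using basis_mem 0)
  rwa [mul_one] at this

theorem exists_expansion [DecidableEq I] (h : IsTrinomial K u z A n) {v : I} (hv : A v = 1)
    (f : B) : ∃ (N : ℕ) (c : ℕ → B), (∀ d, c d ∈ others K u v) ∧
      f = ∑ d ∈ Finset.range N, c d * (z ^ (d % n) * u v ^ (d / n)) := by
  have hf : f ∈ Submodule.span (others K u v)
      (Set.range fun d => z ^ (d % n) * u v ^ (d / n)) := by
    rw [h.span_eq_top hv]; trivial
  obtain ⟨c, rfl⟩ := Finsupp.mem_span_range_iff_exists_finsupp.1 hf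
  refine ⟨c.support.sup id + 1, fun d => c d, fun d => (c d).2, ?_⟩
  refine Finset.sum_subset (fun d hd => ?_) fun d _ hd => ?_
  · exact Finset.mem_range.2 (Nat.lt_succ_of_le (Finset.le_sup (f := id) hd))
  · simp [Finsupp.notMem_support_iff.1 hd]

variable [IsDomain B] [CharZero B]

theorem _root_.LND.HasDeg.pow_add_one {δ : Derivation K B B} {f : B} {e n : ℕ} (hf : HasDeg δ f e)
    (he : e ≠ 0) (hn : n ≠ 0) : HasDeg δ (f ^ n + 1) (n * e) := by
  have h1 {r : ℕ} (hr : r ≠ 0) : δ^[r] (1 : B) = 0 :=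
    iterate_eq_zero_of_le (r := 1) (by omega) (by simp)
  rw [HasDeg, iterate_map_add, iterate_map_add, h1 (mul_ne_zero hn he), h1 (Nat.succ_ne_zero _),
    add_zero, add_zero]
  exact hf.pow n

/-- Compare the degrees of the two sides of `u v ^ A v * cofactor u A v = z ^ n + 1`; the cofactor
has degree 0. -/
theorem mul_deg_eq [DecidableEq I] (h : IsTrinomial K u z A n) {δ : Derivation K B B} {v : I}
    (hδ : ∀ w ≠ v, δ (u w) = 0) {d e : ℕ} (hd : HasDeg δ (u v) d) (he : HasDeg δ z e)
    (he0 : e ≠ 0) : A v * d = n * e := by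
  have h1 := (hd.pow (A v)).mul (hasDeg_zero (h.cofactor_ne_zero v)
    (map_eq_zero_of_mem_others hδ (cofactor_mem_others u A v)))
  rw [h.mul_cofactor v, add_zero] at h1
  exact h1.unique (he.pow_add_one he0 (by have := h.one_lt; omega))

variable [DecidableEq I]

theorem hasDeg_u (h : IsTrinomial K u z A n) {v : I} (hv : A v = 1) {δ : Derivation K B B}
    (hnil : IsLocallyNilpotent δ) (hδ : IsElementary u z v δ) : HasDeg δ (u v) n := by
  obtain ⟨d, hd⟩ := hnil.exists_hasDeg (h.ne_zero v)
  have := h.mul_deg_eq hδ.map_eq_zero hd hδ.hasDeg_z one_ne_zero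
  rw [hv, one_mul, mul_one] at this
  exact this ▸ hd

theorem hasDeg_basis (h : IsTrinomial K u z A n) {v : I} (hv : A v = 1) {δ : Derivation K B B}
    (hnil : IsLocallyNilpotent δ) (hδ : IsElementary u z v δ) (d : ℕ) :
    HasDeg δ (z ^ (d % n) * u v ^ (d / n)) d := by
  have := (hδ.hasDeg_z.pow (d % n)).mul ((h.hasDeg_u hv hnil hδ).pow (d / n))
  rwa [mul_one, Nat.mod_add_div'] at this

/-- An element that is killed by `δ ^ r` is a combination of those basis elements whose degree is
less than `r`. -/
theorem exists_expansion_of_iterate_eq_zero (h : IsTrinomial K u z A n) {v : I} (hv : A v = 1)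
    {δ : Derivation K B B} (hnil : IsLocallyNilpotent δ) (hδ : IsElementary u z v δ) {f : B}
    {r : ℕ} (hf : δ^[r] f = 0) : ∃ c : ℕ → B, (∀ d, c d ∈ others K u v) ∧
      f = ∑ d ∈ Finset.range r, c d * (z ^ (d % n) * u v ^ (d / n)) := by
  obtain ⟨N, c, hc, hfc⟩ := h.exists_expansion hv f
  have hkill (d : ℕ) : δ (c d) = 0 := map_eq_zero_of_mem_others hδ.map_eq_zero (hc d)
  induction N generalizing c with
  | zero => exact ⟨0, fun _ => zero_mem _, by simpa using hfc⟩
  | succ N ih =>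
    rcases lt_or_ge N r with hN | hN
    · refine ⟨fun d => if d < N + 1 then c d else 0, fun d => ?_, ?_⟩
      · dsimp only
        split_ifs
        exacts [hc d, zero_mem _]
      · rw [hfc]
        refine Finset.sum_subset_zero_on_sdiff (Finset.range_mono hN) ?_ ?_
        · intro d hd
          simp only [Finset.mem_sdiff, Finset.mem_range] at hd
          simp [hd.2]
        · intro d hd
          simp [Finset.mem_range.1 hd]
    -- For `N ≥ r`, `δ^[N]` kills `f` and all terms below the top one, so the top coefficient
    -- vanishes.
    · have h0 : δ^[N] f = 0 := iterate_eq_zero_of_le hN hf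
      have hsum : δ^[N] (∑ d ∈ Finset.range N, c d * (z ^ (d % n) * u v ^ (d / n))) = 0 := by
        rw [iterate_map_sum]
        refine Finset.sum_eq_zero fun d hd => ?_
        rw [iterate_mul_of_map_eq_zero (hkill d),
          (h.hasDeg_basis hv hnil hδ d).iterate_eq_zero_iff.2 (Finset.mem_range.1 hd), mul_zero]
      rw [hfc, Finset.sum_range_succ, iterate_map_add, hsum, zero_add,
        iterate_mul_of_map_eq_zero (hkill N)] at h0
      have hcN := (mul_eq_zero.1 h0).resolve_right (h.hasDeg_basis hv hnil hδ N).1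
      exact ih c hc (by rw [hfc, Finset.sum_range_succ, hcN, zero_mul, add_zero]) hkill

theorem map_eq_zero_iff (h : IsTrinomial K u z A n) {v : I} (hv : A v = 1)
    {δ : Derivation K B B} (hnil : IsLocallyNilpotent δ) (hδ : IsElementary u z v δ) {f : B} :
    δ f = 0 ↔ f ∈ others K u v := by
  refine ⟨fun hf => ?_, map_eq_zero_of_mem_others hδ.map_eq_zero⟩
  obtain ⟨c, hc, rfl⟩ := h.exists_expansion_of_iterate_eq_zero hv hnil hδ (r := 1) hf
  simpa using hc 0

/-- A nonzero locally nilpotent derivation that commutes with an elementary one is elementary. -/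
theorem isElementary_of_commute (h : IsTrinomial K u z A n) {v : I} (hv : A v = 1)
    {δ D : Derivation K B B} (hnil : IsLocallyNilpotent δ) (hδ : IsElementary u z v δ)
    (hD : D ≠ 0) (hDnil : IsLocallyNilpotent D) (hcomm : ∀ f, δ (D f) = D (δ f)) :
    IsElementary u z v D := by
  have hn := h.one_lt
  have hker {f : B} := h.map_eq_zero_iff hv hnil hδ (f := f)
  have hpres {f : B} (hf : δ f = 0) : δ (D f) = 0 := by rw [hcomm, hf, D.map_zero]
  -- `D` preserves the kernel of `δ^[2]`, which is spanned over `ker δ` by the basis elements `1`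
  -- and `z`, since `1 < n`.
  obtain ⟨α, β, hα, hβ, hDz⟩ : ∃ α β : B, δ α = 0 ∧ δ β = 0 ∧ D z = α + β * z := by
    have h2 : δ^[2] (D z) = 0 := by
      change δ (δ (D z)) = 0
      rw [hcomm]
      exact hpres hδ.hasDeg_z.2
    obtain ⟨c, hc, hcz⟩ := h.exists_expansion_of_iterate_eq_zero hv hnil hδ h2
    refine ⟨c 0, c 1, hker.2 (hc 0), hker.2 (hc 1), ?_⟩
    simpa [Finset.sum_range_succ, Nat.mod_eq_of_lt hn, Nat.div_eq_of_lt hn] using hcz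
  obtain rfl : β = 0 := by
    by_contra hβ0
    -- If `β ≠ 0`, the coefficient of `z` never dies: `D q + q * β = 0` would make `q` divide `D q`,
    -- whence `D q = 0` and `q * β = 0`. Thus `D` would not be nilpotent on `z`.
    have key (r : ℕ) : ∃ p q : B, δ p = 0 ∧ δ q = 0 ∧ q ≠ 0 ∧ D^[r] z = p + q * z := by
      induction r with
      | zero => exact ⟨0, 1, by simp, by simp, one_ne_zero, by simp⟩
      | succ r ih =>
        obtain ⟨p, q, hp, hq, hq0, hr⟩ := ih
        refine ⟨D p + q * α, D q + q * β, by simp [hpres hp, hq, hα],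
          by simp [hpres hq, hq, hβ], fun h0 => ?_, ?_⟩
        · have hDq : D q = q * -β := by linear_combination h0
          have := hDnil.map_eq_zero_of_dvd_map ⟨_, hDq⟩
          rw [this, zero_add] at h0
          exact (mul_ne_zero hq0 hβ0) h0
        · rw [Function.iterate_succ_apply', hr, map_add, Derivation.leibniz, hDz]
          simp only [smul_eq_mul]
          ring
    obtain ⟨r, hr⟩ := hDnil z
    obtain ⟨p, q, hp, hq, hq0, hpq⟩ := key r
    have := congrArg δ (hpq.symm.trans hr)
    simp only [map_add, Derivation.leibniz, hp, hq, smul_eq_mul, mul_zero, add_zero, zero_add,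
      map_zero] at this
    exact mul_ne_zero hq0 hδ.map_ne_zero this
  rw [zero_mul, add_zero] at hDz
  set P := cofactor u A v with hP
  have hrel : u v * P = z ^ n + 1 := by simpa [hv] using h.mul_cofactor v
  have hδP : δ P = 0 := hker.2 (cofactor_mem_others u A v)
  have hderiv : P * D (u v) + D P * u v = n * α * z ^ (n - 1) := by
    have := congrArg D hrel
    simp only [Derivation.leibniz, Derivation.leibniz_pow, map_add, Derivation.map_one_eq_zero,
      smul_eq_mul, hDz, nsmul_eq_mul, add_zero] at this
    linear_combination this
  -- Apply `δ^[n]` to the differentiated relation. The right side dies because `z ^ (n - 1)` has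
  -- degree `n - 1`; on the left only the coefficient `c n` of `u v` in `D (u v)` counts. Hence `D P
  -- = -c n * P`, and `P` divides `D P`.
  have hDP : D P = 0 := by
    have hu := h.hasDeg_u hv hnil hδ
    have hcomm' (r : ℕ) (f : B) : δ^[r] (D f) = D (δ^[r] f) := by
      induction r with
      | zero => rfl
      | succ r ih => rw [Function.iterate_succ_apply', ih, hcomm, ← Function.iterate_succ_apply' δ]
    obtain ⟨c, hc, hcu⟩ := h.exists_expansion_of_iterate_eq_zero hv hnil hδ
      (f := D (u v)) (r := n + 1) (by rw [hcomm', hu.2, D.map_zero])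
    have hDu : δ^[n] (D (u v)) = c n * δ^[n] (u v) := by
      rw [hcu, Finset.sum_range_succ, iterate_map_add, iterate_map_sum, Finset.sum_eq_zero,
        zero_add, iterate_mul_of_map_eq_zero (hker.2 (hc n)), Nat.mod_self,
        Nat.div_self (by omega), pow_zero, pow_one, one_mul]
      intro d hd
      rw [iterate_mul_of_map_eq_zero (hker.2 (hc d)),
        (h.hasDeg_basis hv hnil hδ d).iterate_eq_zero_iff.2 (Finset.mem_range.1 hd), mul_zero]
    have h1 := congrArg δ^[n] hderiv
    rw [iterate_map_add, iterate_mul_of_map_eq_zero hδP,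
      iterate_mul_of_map_eq_zero (hpres hδP), hDu,
      iterate_mul_of_map_eq_zero (show δ (n * α) = 0 by simp [hα]),
      (hδ.hasDeg_z.pow (n - 1)).iterate_eq_zero_iff.2 (by omega), mul_zero] at h1
    have h2 : (P * c n + D P) * δ^[n] (u v) = 0 := by linear_combination h1
    have h3 := (mul_eq_zero.1 h2).resolve_right hu.1
    exact hDnil.map_eq_zero_of_dvd_map ⟨-c n, by linear_combination h3⟩
  have hD0 : ∀ w ≠ v, D (u w) = 0 := fun w hw =>
    hDnil.map_eq_zero_of_dvd (dvd_cofactor u (h.exponent_ne_zero w) hw) (h.cofactor_ne_zero v) hDP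
  refine ⟨hD0, by rw [hDz]; exact hker.1 hα, fun h0 => hD (h.derivation_eq_zero h0 fun w => ?_)⟩
  by_cases hw : w = v
  · subst hw
    rw [hDz] at h0
    rw [hDP, h0, zero_mul, add_zero, mul_zero, zero_mul] at hderiv
    exact (mul_eq_zero.1 hderiv).resolve_left (h.cofactor_ne_zero w)
  · exact hD0 w hw

theorem isMaximal (h : IsTrinomial K u z A n) {v : I} (hv : A v = 1)
    {δ : Derivation K B B} (hnil : IsLocallyNilpotent δ) (hδ : IsElementary u z v δ) :
    IsMaximal δ where
  ne_zero := fun h0 => hδ.map_ne_zero (by simp [h0])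
  isLocallyNilpotent := hnil
  equivalent_of_commute D hD hDnil hcomm := by
    have hDel := h.isElementary_of_commute hv hnil hδ hD hDnil fun f => by
      have := DFunLike.congr_fun hcomm f
      rwa [Derivation.commutator_apply, Derivation.zero_apply, sub_eq_zero] at this
    ext f
    simp only [LinearMap.mem_ker, Derivation.coeFn_coe]
    rw [h.map_eq_zero_iff hv hnil hδ, h.map_eq_zero_iff hv hDnil hDel]

/-! ### Homogeneous derivations are elementary. -/

/-- A locally nilpotent derivation that behaves like a homogeneous one on the generators is
elementary. -/
theorem exists_isElementary [IsAlgClosed K] (h : IsTrinomial K u z A n) {δ : Derivation K B B}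
    (hnil : IsLocallyNilpotent δ) (hz : δ z ≠ 0) {b : I → ℕ} {q : Polynomial K}
    (hδz : δ z = (∏ w, u w ^ b w) * Polynomial.aeval z q) (hb : ∃ w, b w < A w)
    (hu : ∀ v, δ (u v) ≠ 0 → ∃ (b' : I → ℕ) (q' : Polynomial K) (t : ℤ),
      δ (u v) = (∏ w, u w ^ b' w) * Polynomial.aeval z q' ∧ (∃ w, b' w < A w) ∧
      ∀ w, (b w : ℤ) + (if w = v then 1 else 0) - b' w = t * A w) :
    ∃ v, A v = 1 ∧ IsElementary u z v δ := by
  have hn := h.one_lt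
  -- Otherwise `q` has a root `r`, and `z - r` divides `δ z = δ (z - r)`.
  obtain ⟨c, rfl⟩ : ∃ c, q = Polynomial.C c := by
    refine ⟨q.coeff 0, Polynomial.eq_C_of_degree_eq_zero ?_⟩
    by_contra hq
    obtain ⟨r, hr⟩ := IsAlgClosed.exists_root q hq
    obtain ⟨q, rfl⟩ := Polynomial.dvd_iff_isRoot.2 hr
    refine hz ?_
    have hsub : δ (z - algebraMap K B r) = δ z := by simp
    rw [← hsub]
    refine hnil.map_eq_zero_of_dvd_map ?_
    rw [hsub, hδz]
    exact Dvd.intro_left ((∏ w, u w ^ b w) * Polynomial.aeval z q) (by simp; ring)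
  -- The claim follows from `t ≥ 1`. A negative `t` would make an exponent on the left negative at
  -- `w'`; `t = 0` gives `b' v = b v + 1`, so `u v` would divide `δ (u v)`.
  have hge (v : I) (hv : δ (u v) ≠ 0) (w : I) : A w ≤ b w + if w = v then 1 else 0 := by
    obtain ⟨b', q', t, hq', ⟨w', hw'⟩, ht⟩ := hu v hv
    rcases lt_trichotomy t 0 with ht0 | rfl | ht0
    · have h1 := ht w'
      have h2 : (A w' : ℤ) ≤ -t * A w' := le_mul_of_one_le_left (by positivity) (by omega)
      split_ifs at h1 <;> nlinarith
    · refine absurd (hnil.map_eq_zero_of_dvd_map ?_) hv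
      have h1 := ht v
      rw [if_pos rfl] at h1
      rw [hq']
      exact ((dvd_pow_self _ (by omega)).trans
        (Finset.dvd_prod_of_mem (fun w => u w ^ b' w) (Finset.mem_univ v))).mul_right _
    · have h1 := ht w
      have h2 : (A w : ℤ) ≤ t * A w := le_mul_of_one_le_left (by positivity) (by omega)
      split_ifs at h1 ⊢ <;> omega
  obtain ⟨v, hv⟩ : ∃ v, δ (u v) ≠ 0 := by
    by_contra! h0
    have h1 : δ (∏ v, u v ^ A v) = 0 := Finset.prod_induction _ (fun f => δ f = 0)
      (fun f g hf hg => by simp [hf, hg]) (by simp) fun v _ => by simp [h0 v]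
    rw [h.prod_eq, map_add, Derivation.map_one_eq_zero, add_zero, Derivation.leibniz_pow] at h1
    have hz0 : z ≠ 0 := fun h0 => hz (by rw [h0, δ.map_zero])
    simp only [nsmul_eq_mul, smul_eq_mul, mul_eq_zero, Nat.cast_eq_zero] at h1
    rcases h1 with h1 | h1 | h1
    exacts [by omega, pow_ne_zero _ hz0 h1, hz h1]
  -- By `hge`, an index `x` with `b x < A x` must coincide with every index whose `u` is not killed.
  have hδ : ∀ w ≠ v, δ (u w) = 0 := by
    intro w hw
    by_contra hne
    obtain ⟨x, hx⟩ := hb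
    have h1 := hge v hv x
    have h2 := hge w hne x
    split_ifs at h1 h2 with hxv hxw <;> first | omega | exact hw (hxw.symm.trans hxv)
  have hbv : b v + 1 = A v := by
    obtain ⟨x, hx⟩ := hb
    have h1 := hge v hv x
    have h2 := hge v hv v
    rw [if_pos rfl] at h2
    split_ifs at h1 with hxv
    · subst hxv; omega
    · omega
  -- With `d` the degree of `u v` and `e + 1` that of `z`, the relation gives `(b v + 1) * d = n *
  -- (e + 1)`, and `δ z` gives `b v * d ≤ e`. For `b v ≥ 1` and `n ≥ 2` these are incompatible.
  have hAv : A v = 1 := by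
    obtain ⟨d, hd⟩ := hnil.exists_hasDeg (h.ne_zero v)
    obtain ⟨e, he⟩ := hnil.exists_hasDeg (f := z) fun h0 => hz (by rw [h0, δ.map_zero])
    obtain ⟨e, rfl⟩ : ∃ e', e = e' + 1 := Nat.exists_eq_succ_of_ne_zero (by
      rintro rfl
      exact hz he.2)
    have h1 := h.mul_deg_eq hδ hd he (Nat.succ_ne_zero e)
    have h2 := he.map
    rw [hδz, ← Finset.mul_prod_erase _ (fun w => u w ^ b w) (Finset.mem_univ v), mul_assoc] at h2
    obtain ⟨r, hr⟩ := hnil.exists_hasDeg (right_ne_zero_of_mul h2.ne_zero)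
    have h3 := h2.unique ((hd.pow (b v)).mul hr)
    by_contra hne
    rw [← hbv] at h1 hne
    have hb1 : 1 ≤ b v := by omega
    have h4 : b v * 2 * (e + 1) ≤ b v * n * (e + 1) := by gcongr; omega
    have h5 : (b v + 1) * (b v * d) ≤ (b v + 1) * e := by gcongr; omega
    have h6 : (b v + 1) * (b v * d) = b v * n * (e + 1) := by
      rw [mul_left_comm, h1, mul_assoc]
    have h7 : (b v + 1) * (e + 1) ≤ b v * 2 * (e + 1) := by gcongr; omega
    have h8 : (b v + 1) * e < (b v + 1) * (e + 1) := by gcongr; omega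
    omega
  refine ⟨v, hAv, hδ, ?_, hz⟩
  rw [hδz, Polynomial.aeval_C]
  refine mul_mem (prod_mem fun w _ => ?_) (Subalgebra.algebraMap_mem _ c)
  by_cases hw : w = v
  · subst hw
    rw [show b w = 0 by omega, pow_zero]
    exact one_mem _
  · exact pow_mem (mem_others u hw) _

end IsTrinomial

end Trinomial

end LND

namespace LND

open MvPolynomial

/-! ### The coordinate ring as a trinomial algebra. -/

section Concrete

/-- The variables other than `z`. -/
def otherVar {k m : ℕ} : Fin k ⊕ Fin m → Var k m :=
  Sum.elim Var.x Var.y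

/-- The exponents of the variables other than `z` in the equation of the hypersurface. -/
def exponent (k : ℕ) {m : ℕ} (a : Fin m → ℕ) : Fin k ⊕ Fin m → ℕ :=
  Sum.elim (fun _ => 1) a

theorem otherVar_injective {k m : ℕ} : Function.Injective (otherVar (k := k) (m := m)) := by
  rintro (i | i) (j | j) h <;> simp_all [otherVar]

theorem otherVar_ne_z {k m : ℕ} (v : Fin k ⊕ Fin m) : otherVar v ≠ Var.z := by
  rcases v with i | j <;> simp [otherVar]

theorem Var.eq_z_or {k m : ℕ} (v : Var k m) : v = Var.z ∨ ∃ w, otherVar w = v := by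
  rcases v with i | j | _
  exacts [Or.inr ⟨Sum.inl i, rfl⟩, Or.inr ⟨Sum.inr j, rfl⟩, Or.inl rfl]

variable (K : Type*) [Field K] {k m : ℕ} (a : Fin m → ℕ) (n : ℕ)

theorem equation_eq : equation K (k := k) a n =
    ∏ v, X (otherVar v) ^ exponent k a v - (X Var.z ^ n + 1) := by
  simp [equation, otherVar, exponent, Fintype.prod_sum_type]

/-- The equation is linear in `x₁`, with coefficients relatively prime because no variable of the
product divides `z ^ n + 1`, as evaluation at the origin shows. -/
theorem equation_irreducible (hk : 1 ≤ k) (hn : n ≠ 0) : Irreducible (equation K (k := k) a n) := by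
  classical
  let v₀ : Fin k ⊕ Fin m := Sum.inl ⟨0, hk⟩
  have heq : equation K (k := k) a n =
      (∏ v ∈ Finset.univ.erase v₀, X (otherVar v) ^ exponent k a v) * X (otherVar v₀)
        + -(X Var.z ^ n + 1) := by
    rw [equation_eq, ← Finset.prod_erase_mul _ _ (Finset.mem_univ v₀),
      show exponent k a v₀ = 1 from rfl, pow_one, sub_eq_add_neg]
  rw [heq]
  refine irreducible_mul_X_add _ _ _ ?_ ?_ ?_ ?_
  · exact Finset.prod_ne_zero_iff.2 fun v _ => pow_ne_zero _ (X_ne_zero _)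
  · intro h
    obtain ⟨v, hv, h⟩ := Finset.mem_biUnion.1 (vars_prod _ h)
    have h := vars_pow _ _ h
    rw [vars_X, Finset.mem_singleton] at h
    exact Finset.ne_of_mem_erase hv (otherVar_injective h.symm)
  · rw [vars_neg]
    intro h
    rcases Finset.mem_union.1 (vars_add_subset _ _ h) with h | h
    · have h := vars_pow _ _ h
      rw [vars_X, Finset.mem_singleton] at h
      exact otherVar_ne_z v₀ h
    · simp at h
  · refine IsRelPrime.prod_left fun v _ => IsRelPrime.pow_left ?_
    refine (X_prime (R := K) (i := otherVar v)).irreducible.isRelPrime_iff_not_dvd.2 fun h => ?_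
    have := map_dvd (eval (fun _ : Var k m => (0 : K))) h
    simp [hn] at this

theorem isDomain_coordRing (hk : 1 ≤ k) (hn : n ≠ 0) : IsDomain (CoordRing K k a n) := by
  have h := equation_irreducible K a n hk hn
  have := (Ideal.span_singleton_prime h.ne_zero).2 h.prime
  exact Ideal.Quotient.isDomain _

/-- The class of a polynomial in the coordinate ring. -/
noncomputable abbrev toCoord (k : ℕ) {m : ℕ} (a : Fin m → ℕ) (n : ℕ) :
    MvPolynomial (Var k m) K →ₐ[K] CoordRing K k a n :=
  Ideal.Quotient.mkₐ K (Ideal.span {equation K (k := k) a n})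

theorem toCoord_eq_zero_iff {p : MvPolynomial (Var k m) K} :
    toCoord K k a n p = 0 ↔ p ∈ Ideal.span {equation K (k := k) a n} :=
  Ideal.Quotient.eq_zero_iff_mem

/-- The class of a variable in the coordinate ring. -/
noncomputable abbrev coordVar (v : Var k m) : CoordRing K k a n :=
  toCoord K k a n (X v)

theorem prod_coordVar : ∏ v, coordVar K a n (otherVar v) ^ exponent k a v =
    coordVar K a n (Var.z : Var k m) ^ n + 1 := by
  have h : toCoord K k a n (∏ v, X (otherVar v) ^ exponent k a v - (X Var.z ^ n + 1)) = 0 :=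
    (toCoord_eq_zero_iff K a n).2 (Ideal.mem_span_singleton.2 (equation_eq K a n).dvd)
  rw [map_sub, sub_eq_zero] at h
  simpa only [map_prod, map_pow, map_add, map_one] using h

theorem isTrinomial (hn : 1 < n) (ha : ∀ j, 1 < a j) :
    IsTrinomial K (fun v => coordVar K a n (otherVar v)) (coordVar K a n (Var.z : Var k m))
      (exponent k a) n where
  prod_eq := prod_coordVar K a n
  adjoin_eq_top := by
    have h := congrArg (Subalgebra.map (toCoord K k a n)) (adjoin_range_X (R := K) (σ := Var k m))
    rw [AlgHom.map_adjoin, Algebra.map_top,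
      (AlgHom.range_eq_top _).2 (Ideal.Quotient.mkₐ_surjective K _)] at h
    rw [← h]
    congr 1
    ext f
    simp only [Set.mem_insert_iff, Set.mem_range, Set.mem_image, exists_exists_eq_and]
    constructor
    · rintro (rfl | ⟨v, rfl⟩)
      exacts [⟨_, rfl⟩, ⟨_, rfl⟩]
    · rintro ⟨v, rfl⟩
      obtain rfl | ⟨w, rfl⟩ := v.eq_z_or
      exacts [Or.inl rfl, Or.inr ⟨w, rfl⟩]
  ne_zero v h := by
    classical
    have h := Ideal.mem_span_singleton.1 ((toCoord_eq_zero_iff K a n).1 h)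
    -- This point lies on the hypersurface, and the variable takes the value 1 there.
    have := map_dvd (eval (fun v : Var k m => if v = Var.z then (0 : K) else 1)) h
    rw [equation_eq] at this
    simp [otherVar_ne_z, show n ≠ 0 by omega] at this
  exponent_ne_zero := by
    rintro (i | j)
    exacts [one_ne_zero, (zero_lt_one.trans (ha j)).ne']
  one_lt := hn

/-! ### The torus grading and its homogeneous elements. -/

/-- The canonical map to the character group of the torus. -/
noncomputable def toTorus (k : ℕ) {m : ℕ} (a : Fin m → ℕ) (n : ℕ) :
    (Var k m → ℤ) →+ TorusGradingGroup k a n :=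
  (QuotientAddGroup.mk' _).comp (QuotientAddGroup.mk' _)

open Classical in
theorem toTorus_single (v : Var k m) : toTorus k a n (Pi.single v 1) = torusWeight a n v :=
  rfl

theorem weight_torusWeight (s : Var k m →₀ ℕ) :
    Finsupp.weight (torusWeight a n) s = toTorus k a n (fun v => (s v : ℤ)) := by
  classical
  induction s using Finsupp.induction_linear with
  | zero => rw [map_zero]; exact (map_zero (toTorus k a n)).symm
  | add s t hs ht =>
    rw [map_add, hs, ht, ← map_add]
    congr 1
  | single v c =>
    have h : (fun w => ((Finsupp.single v c : Var k m →₀ ℕ) w : ℤ)) =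
        c • (Pi.single v (1 : ℤ) : Var k m → ℤ) := by
      ext w
      by_cases hw : w = v
      · subst hw; simp
      · simp [hw]
    rw [Finsupp.weight_single, h, map_nsmul]
    congr 2

theorem toTorus_rowXY : toTorus k a n (rowXY k a) = 0 := by
  have h : (QuotientAddGroup.mk' (AddSubgroup.closure {rowXY k a, rowZ k m n})) (rowXY k a) = 0 :=
    (QuotientAddGroup.eq_zero_iff _).2 (AddSubgroup.subset_closure (by simp))
  rw [toTorus, AddMonoidHom.comp_apply, h, map_zero]

theorem toTorus_rowZ : toTorus k a n (rowZ k m n) = 0 := by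
  have h : (QuotientAddGroup.mk' (AddSubgroup.closure {rowXY k a, rowZ k m n})) (rowZ k m n) = 0 :=
    (QuotientAddGroup.eq_zero_iff _).2 (AddSubgroup.subset_closure (by simp))
  rw [toTorus, AddMonoidHom.comp_apply, h, map_zero]

theorem rowXY_otherVar (v : Fin k ⊕ Fin m) : rowXY k a (otherVar v) = exponent k a v := by
  rcases v with i | j <;> simp [otherVar, rowXY, exponent]

theorem rowZ_otherVar (v : Fin k ⊕ Fin m) : rowZ k m n (otherVar v) = 0 := by
  rcases v with i | j <;> simp [otherVar, rowZ]

/-- Monomials of the same degree for the torus differ by a power of `∏ u v ^ exponent v`, up to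
powers of `z`. -/
theorem exists_eq_mul_of_toTorus_eq_zero (hk : 1 ≤ k) {d : Var k m → ℤ}
    (hd : toTorus k a n d = 0) : ∃ t : ℤ, ∀ v, d (otherVar v) = t * exponent k a v := by
  have h1 := (QuotientAddGroup.eq_zero_iff (N := AddCommGroup.torsion (GradingGroup k a n)) _).1 hd
  obtain ⟨N, hN, h2⟩ := isOfFinAddOrder_iff_nsmul_eq_zero.1 h1
  rw [← map_nsmul] at h2
  have h3 := (QuotientAddGroup.eq_zero_iff _).1 h2
  obtain ⟨t, r, h4⟩ := AddSubgroup.mem_closure_pair.1 h3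
  have h5 (v : Fin k ⊕ Fin m) : t * exponent k a v = N * d (otherVar v) := by
    have := congrFun h4 (otherVar v)
    simpa [rowXY_otherVar, rowZ_otherVar] using this
  -- A multiple `N • d` lies in the span of the rows. As `x₁` has exponent 1, `t = N * d x₁`, so `N`
  -- cancels.
  refine ⟨d (otherVar (Sum.inl ⟨0, hk⟩)), fun v => ?_⟩
  have h6 := h5 (Sum.inl ⟨0, hk⟩)
  simp only [exponent, Sum.elim_inl, Nat.cast_one, mul_one] at h6
  have h7 := h5 v
  rw [h6, mul_assoc] at h7
  exact (mul_left_cancel₀ (by positivity) h7).symm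

theorem exists_eq_mul_of_weight_eq (hk : 1 ≤ k) {s s' : Var k m →₀ ℕ}
    (h : Finsupp.weight (torusWeight a n) s = Finsupp.weight (torusWeight a n) s') :
    ∃ t : ℤ, ∀ v, (s (otherVar v) : ℤ) - s' (otherVar v) = t * exponent k a v := by
  rw [weight_torusWeight, weight_torusWeight, ← sub_eq_zero, ← map_sub] at h
  exact exists_eq_mul_of_toTorus_eq_zero a n hk h

theorem equation_isWeightedHomogeneous :
    IsWeightedHomogeneous (torusWeight a n) (equation K (k := k) a n) 0 := by
  classical
  have hX (v : Var k m) (r : ℕ) : IsWeightedHomogeneous (torusWeight a n) (X v ^ r : MvPolynomial _ K)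
      (toTorus k a n (r • Pi.single v 1)) := by
    have := (isWeightedHomogeneous_X K (torusWeight a n) v).pow r
    rw [map_nsmul]
    convert this using 2
    exact toTorus_single a n v
  rw [equation_eq]
  refine IsWeightedHomogeneous.sub ?_ (IsWeightedHomogeneous.add ?_
    (isWeightedHomogeneous_one K _))
  · have := IsWeightedHomogeneous.prod Finset.univ _ _ fun v _ => hX (otherVar v) (exponent k a v)
    have hrow : ∑ v, exponent k a v • (Pi.single (otherVar v) 1 : Var k m → ℤ) = rowXY k a := ?_
    · rwa [← map_sum, hrow, toTorus_rowXY] at this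
    ext v
    obtain rfl | ⟨w, rfl⟩ := v.eq_z_or
    · simp [rowXY, Finset.sum_apply, (otherVar_ne_z _).symm]
    · simp [rowXY_otherVar, Finset.sum_apply, Pi.single_apply, otherVar_injective.eq_iff]
  · have hrow : n • (Pi.single Var.z 1 : Var k m → ℤ) = rowZ k m n := ?_
    · simpa only [hrow, toTorus_rowZ] using hX Var.z n
    ext v
    obtain rfl | ⟨w, rfl⟩ := v.eq_z_or
    · simp [rowZ]
    · simp [rowZ_otherVar, otherVar_ne_z]

/-- Components of different degrees are independent. -/
theorem eq_of_add_mem_component {g₁ g₂ g₃ : TorusGradingGroup k a n} {f₁ f₂ : CoordRing K k a n}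
    (h₁ : f₁ ∈ component K a n (torusWeight a n) g₁)
    (h₂ : f₂ ∈ component K a n (torusWeight a n) g₂) (hf₁ : f₁ ≠ 0) (hf₂ : f₂ ≠ 0)
    (h₃ : f₁ + f₂ ∈ component K a n (torusWeight a n) g₃) : g₁ = g₂ := by
  classical
  obtain ⟨p₁, hp₁, rfl⟩ := h₁
  obtain ⟨p₂, hp₂, rfl⟩ := h₂
  obtain ⟨p₃, hp₃, h⟩ := h₃
  let _ := weightedGradedAlgebra K (torusWeight (k := k) a n)
  have hJ : (Ideal.span {equation K (k := k) a n}).IsHomogeneous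
      (weightedHomogeneousSubmodule K (torusWeight a n)) := by
    refine Ideal.homogeneous_span _ _ ?_
    rintro _ rfl
    exact ⟨0, equation_isWeightedHomogeneous K a n⟩
  have hmem : p₁ + p₂ - p₃ ∈ Ideal.span {equation K (k := k) a n} := by
    rw [← toCoord_eq_zero_iff, map_sub, map_add, sub_eq_zero]
    exact h.symm
  have hcomp := weightedHomogeneousComponent_mem_of_mem K (torusWeight (k := k) a n) hJ hmem
  have hp₁' := (mem_weightedHomogeneousSubmodule _ _ _ _).1 hp₁
  have hp₂' := (mem_weightedHomogeneousSubmodule _ _ _ _).1 hp₂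
  have hp₃' := (mem_weightedHomogeneousSubmodule _ _ _ _).1 hp₃
  by_contra hne
  -- If `g₁ ≠ g₂`, one of them differs from `g₃`, and the component of `p₁ + p₂ - p₃` in that degree
  -- is `p₁` or `p₂`, which then lies in the ideal.
  by_cases h13 : g₁ = g₃
  · have := hcomp g₂
    rw [map_sub, map_add, hp₁'.weightedHomogeneousComponent_ne _ (Ne.symm hne),
      hp₃'.weightedHomogeneousComponent_ne _ (fun h => hne (h13.trans h.symm)),
      hp₂'.weightedHomogeneousComponent_same, zero_add, sub_zero] at this
    exact hf₂ ((toCoord_eq_zero_iff K a n).2 this)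
  · have := hcomp g₁
    rw [map_sub, map_add, hp₂'.weightedHomogeneousComponent_ne _ hne,
      hp₃'.weightedHomogeneousComponent_ne _ h13,
      hp₁'.weightedHomogeneousComponent_same, add_zero, sub_zero] at this
    exact hf₁ ((toCoord_eq_zero_iff K a n).2 this)

theorem toCoord_monomial (s : Var k m →₀ ℕ) (r : K) : toCoord K k a n (monomial s r) =
    r • ((∏ v, coordVar K a n (otherVar v) ^ s (otherVar v)) *
      coordVar K a n (Var.z : Var k m) ^ s Var.z) := by
  classical
  rw [show monomial s r = r • monomial s (1 : K) by
    rw [smul_monomial, smul_eq_mul, mul_one], map_smul]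
  congr 1
  induction s using Finsupp.induction_linear with
  | zero => simp
  | add s t hs ht =>
    rw [show monomial (s + t) (1 : K) = monomial s 1 * monomial t 1 by simp, map_mul, hs, ht]
    simp only [Finsupp.add_apply, pow_add, Finset.prod_mul_distrib]
    ring
  | single v c =>
    rw [show monomial (Finsupp.single v c) (1 : K) = X v ^ c by simp [X_pow_eq_monomial], map_pow]
    obtain rfl | ⟨w, rfl⟩ := v.eq_z_or
    · simp [(otherVar_ne_z _).symm, coordVar]
    · simp [Finsupp.single_apply, otherVar_ne_z, otherVar_injective.eq_iff, coordVar]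

theorem exists_reduced {I : Type*} [Nonempty I] {A : I → ℕ} (hA : ∀ v, A v ≠ 0) (c : I → ℕ) :
    ∃ (b : I → ℕ) (t : ℕ), (∃ w, b w < A w) ∧ ∀ v, c v = b v + t * A v := by
  obtain ⟨i⟩ := ‹Nonempty I›
  induction h : c i using Nat.strong_induction_on generalizing c with
  | _ N ih =>
    by_cases hc : ∃ w, c w < A w
    · exact ⟨c, 0, hc, by simp⟩
    · push Not at hc
      have h1 := hc i
      have h2 := hA i
      obtain ⟨b, t, hb, hbt⟩ := ih (c i - A i) (by omega) (fun v => c v - A v) rfl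
      refine ⟨b, t + 1, hb, fun v => ?_⟩
      have h3 := hbt v
      have h4 := hc v
      rw [add_mul]
      omega

/-- A nonzero element of a component for the torus grading is the product of a monomial not
divisible by `∏ u v ^ exponent v` and a polynomial in `z`. -/
theorem exists_eq_of_mem_component (hk : 1 ≤ k) (hA : ∀ v, exponent k a v ≠ 0)
    {g : TorusGradingGroup k a n} {f : CoordRing K k a n} (hf : f ≠ 0)
    (h : f ∈ component K a n (torusWeight a n) g) :
    ∃ (b : Fin k ⊕ Fin m → ℕ) (q : Polynomial K) (s : Var k m →₀ ℕ) (t : ℕ),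
      f = (∏ v, coordVar K a n (otherVar v) ^ b v) *
        Polynomial.aeval (coordVar K a n (Var.z : Var k m)) q ∧
      (∃ w, b w < exponent k a w) ∧ Finsupp.weight (torusWeight a n) s = g ∧
      ∀ v, s (otherVar v) = b v + t * exponent k a v := by
  obtain ⟨p, hp, rfl⟩ := h
  have hp0 : p ≠ 0 := by rintro rfl; exact hf (map_zero _)
  obtain ⟨s, hs⟩ := ne_zero_iff.1 hp0
  have : Nonempty (Fin k ⊕ Fin m) := ⟨Sum.inl ⟨0, hk⟩⟩
  obtain ⟨b, t, ⟨w, hw⟩, hbt⟩ := exists_reduced hA fun v => s (otherVar v)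
  have hrange : toCoord K k a n p ∈ LinearMap.range
      (LinearMap.mulLeft K (∏ v, coordVar K a n (otherVar v) ^ b v) ∘ₗ
        (Polynomial.aeval (coordVar K a n (Var.z : Var k m))).toLinearMap) := by
    rw [← support_sum_monomial_coeff p, map_sum]
    refine Submodule.sum_mem _ fun s' hs' => ?_
    obtain ⟨t', ht'⟩ := exists_eq_mul_of_weight_eq a n hk
      ((hp (mem_support_iff.1 hs')).trans (hp hs).symm)
    -- A negative `t + t'` would make the exponent of `s'` at `w` negative, as `b w < exponent k a
    -- w`. The surplus `r` copies of the full product become `(z ^ n + 1) ^ r`.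
    obtain ⟨r, hr⟩ : ∃ r : ℕ, t + t' = r := by
      refine ⟨(t + t').toNat, (Int.toNat_of_nonneg ?_).symm⟩
      by_contra! hlt
      have h1 := ht' w
      rw [hbt w] at h1
      push_cast at h1
      nlinarith
    have hr' (v) : s' (otherVar v) = b v + exponent k a v * r := by
      have h1 := ht' v
      rw [hbt v] at h1
      zify
      rw [← hr]
      push_cast at h1
      linear_combination h1
    refine ⟨coeff s' p • ((Polynomial.X ^ n + 1) ^ r * Polynomial.X ^ s' Var.z), ?_⟩
    rw [toCoord_monomial, map_smul]
    congr 1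
    simp only [hr', pow_add, pow_mul, Finset.prod_mul_distrib, Finset.prod_pow, prod_coordVar]
    simp [-Fintype.prod_sum_type]
    ring
  obtain ⟨q, hq⟩ := hrange
  exact ⟨b, q, s, t, hq.symm, ⟨w, hw⟩, hp hs, hbt⟩

theorem mul_mem_component (v : Var k m) {g : TorusGradingGroup k a n} {f : CoordRing K k a n}
    (h : f ∈ component K a n (torusWeight a n) g) :
    coordVar K a n v * f ∈ component K a n (torusWeight a n) (torusWeight a n v + g) := by
  obtain ⟨p, hp, rfl⟩ := h
  exact ⟨X v * p, (isWeightedHomogeneous_X K _ v).mul hp, map_mul (toCoord K k a n) _ _⟩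

theorem isWeightedHomogeneous_torusWeight {p : MvPolynomial (Var k m) K} {g : GradingGroup k a n}
    (hp : IsWeightedHomogeneous (weight a n) p g) :
    IsWeightedHomogeneous (torusWeight a n) p (QuotientAddGroup.mk g) := by
  intro s hs
  rw [← hp hs, Finsupp.weight_apply, Finsupp.weight_apply,
    ← QuotientAddGroup.mk'_apply, map_finsuppSum]
  simp only [map_nsmul]
  rfl

/-- The images of the monomials under a homogeneous derivation are homogeneous for the torus. -/
theorem map_mem_component {δ : Derivation K (CoordRing K k a n) (CoordRing K k a n)}
    (hhom : IsQuasitorusHomogeneous K a n δ ∨ IsTorusHomogeneous K a n δ)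
    {p : MvPolynomial (Var k m) K} {g : GradingGroup k a n}
    (hp : IsWeightedHomogeneous (weight a n) p g) :
    ∃ g', δ (toCoord K k a n p) ∈ component K a n (torusWeight a n) g' := by
  rcases hhom with h | h
  · obtain ⟨g', p', hp', hg'⟩ := h _ ⟨g, p, hp, rfl⟩
    exact ⟨_, p', isWeightedHomogeneous_torusWeight K a n hp', hg'⟩
  · exact h _ ⟨_, p, isWeightedHomogeneous_torusWeight K a n hp, rfl⟩

end Concrete

end LND

/-! ### The theorem. -/

theorem mainTheorem7 (K : Type*) [Field K] [IsAlgClosed K] [CharZero K]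
    (k m n : ℕ) (a : Fin m → ℕ) (hk : 1 ≤ k) (hn : 1 < n) (ha : ∀ j, 1 < a j)
    (δ : Derivation K (LND.CoordRing K k a n) (LND.CoordRing K k a n))
    (hδ : δ ≠ 0) (hnil : LND.IsLocallyNilpotent δ)
    (hhom : LND.IsQuasitorusHomogeneous K a n δ ∨ LND.IsTorusHomogeneous K a n δ) :
    LND.IsMaximal δ := by
  classical
  open LND MvPolynomial in
  have := isDomain_coordRing K (k := k) a n hk (by omega)
  have : CharZero (CoordRing K k a n) :=
    charZero_of_injective_algebraMap (algebraMap K (CoordRing K k a n)).injective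
  have htri := isTrinomial K (k := k) a n hn ha
  have hA := htri.exponent_ne_zero
  -- If `δ` killed `z`, it would kill `z ^ n + 1` and therefore all of its factors `u v`.
  have hz : δ (coordVar K a n Var.z) ≠ 0 := fun h0 => by
    refine hδ (htri.derivation_eq_zero h0 fun v => ?_)
    have hprod : coordVar K a n (Var.z : Var k m) ^ n + 1 ≠ 0 := by
      rw [← htri.prod_eq]
      exact Finset.prod_ne_zero_iff.2 fun v _ => pow_ne_zero _ (htri.ne_zero v)
    refine hnil.map_eq_zero_of_dvd ?_ hprod (by simp [Derivation.leibniz_pow, h0])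
    rw [← htri.prod_eq]
    exact (dvd_pow_self _ (hA v)).trans (Finset.dvd_prod_of_mem
      (fun v => coordVar K a n (otherVar v) ^ exponent k a v) (Finset.mem_univ v))
  obtain ⟨g, hg⟩ := map_mem_component K a n hhom (isWeightedHomogeneous_X K (weight a n) Var.z)
  obtain ⟨b, q, s, t, hq, hb, hs, hst⟩ := exists_eq_of_mem_component K a n hk hA hz hg
  obtain ⟨v, hv, hel⟩ := htri.exists_isElementary hnil hz hq hb fun v hv => by
    obtain ⟨g', hg'⟩ := map_mem_component K a n hhom
      (isWeightedHomogeneous_X K (weight a n) (otherVar v))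
    obtain ⟨b', q', s', t', hq', hb', hs', hst'⟩ := exists_eq_of_mem_component K a n hk hA hv hg'
    -- Homogeneity does not provide a common degree shift. It is recovered from `δ (u v * z)`: this
    -- is homogeneous, so its two nonzero Leibniz summands have equal degree.
    obtain ⟨g'', hg''⟩ := map_mem_component K a n hhom
      ((isWeightedHomogeneous_X K (weight a n) (otherVar v)).mul
        (isWeightedHomogeneous_X K (weight a n) Var.z))
    rw [map_mul, Derivation.leibniz, smul_eq_mul, smul_eq_mul] at hg''
    have hz0 : coordVar K a n (Var.z : Var k m) ≠ 0 := fun h0 => hz (by rw [h0, δ.map_zero])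
    have hdeg := eq_of_add_mem_component K a n (mul_mem_component K a n _ hg)
      (mul_mem_component K a n _ hg') (mul_ne_zero (htri.ne_zero v) hz) (mul_ne_zero hz0 hv) hg''
    obtain ⟨r, hr⟩ := exists_eq_mul_of_weight_eq a n hk
      (s := Finsupp.single (otherVar v) 1 + s) (s' := Finsupp.single Var.z 1 + s') (by
        rw [map_add, map_add, hs, hs', Finsupp.weight_single, Finsupp.weight_single, one_smul,
          one_smul, hdeg])
    refine ⟨b', q', r - t + t', hq', hb', fun w => ?_⟩
    have h1 := hr w
    simp only [Finsupp.add_apply, Finsupp.single_apply, otherVar_injective.eq_iff,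
      (otherVar_ne_z w).symm, if_false, hst, hst', eq_comm (a := v)] at h1
    push_cast at h1
    linear_combination h1
  exact htri.isMaximal hv hnil hel
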